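/- Let $k$ be a field and let $n \ge 2$ be a natural number. By a module we mean a functor $M\colon \mathbb{R}^n \to \mathrm{vec}_k$ from the poset $\mathbb{R}^n$ (product order) to finite dimensional $k$-vector spaces; it is *fp* if it is the cokernel of a morphism between finite direct sums of interval modules with supports of the form $\{r : r \ge i\}$, $i \in \mathbb{R}^n$. For $\epsilon \ge 0$ let $M[\epsilon](r) = M(r + (\epsilon,\dots,\epsilon))$. An $\epsilon$-interleaving between $M$ and $N$ is a pair of morphisms $M \to N[\epsilon]$, $N \to M[\epsilon]$ whose two composites $M \to M[2\epsilon]$, $N \to N[2\epsilon]$ are given by the structure morphisms, and $d_I(M,N) \in [0,\infty]$ is the infimum of all $\epsilon \ge 0$ such that $M$ and $N$ are $\epsilon$-interleaved. A barcode is a finite multiset of isomorphism classes of indecomposable modules, and a signed barcode is an ordered pair $\mathcal{C} = (\mathcal{C}_+, \mathcal{C}_-)$ of barcodes. An $\epsilon$-matching between two barcodes is a partial bijection (counting multiplicities) such that matched bars are $\epsilon$-interleaved and unmatched bars are $\epsilon$-interleaved with the zero module. The bottleneck distance $d_B \in [0,\infty]$ is the infimum of all $\epsilon \ge 0$ such that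 an $\epsilon$-matching exists, and the signed bottleneck dissimilarity is $\widehat{d_B}(\mathcal{C},\mathcal{D}) = d_B(\mathcal{C}_+ \cup \mathcal{D}_-,\, \mathcal{D}_+ \cup \mathcal{C}_-)$, where $\cup$ adds multiplicities. The minimal rank decomposition by rectangles of an fp module $M$ is the unique signed barcode $\mathcal{B}(M) = (\mathcal{B}_+(M), \mathcal{B}_-(M))$ such that all its bars are right open rectangle modules (interval modules with support $[a_1,b_1)\times\dots\times[a_n,b_n)$, where $a_i \in \mathbb{R}$, $b_i \in \mathbb{R}\cup\{\infty\}$, $a_i < b_i$), $\mathcal{B}_+(M)$ and $\mathcal{B}_-(M)$ are disjoint, and for all $a \le b$ in $\mathbb{R}^n$ $$\operatorname{rank}\big(M(a)\to M(b)\big) = \sum_{A \in \mathcal{B}_+(M)} \operatorname{rank}\big(A(a)\to A(b)\big) - \sum_{B \in \mathcal{B}_-(M)} \operatorname{rank}\big(B(a)\to B(b)\big).$$ Then there is no function $f\colon \mathbb{R}_{\ge 0} \to \mathbb{R}_{\ge 0}$ with $f(r) \to 0$ as $r \to 0$ such that $$\widehat{d_B}\big(\mathcal{B}(M), \mathcal{B}(N)\big)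 \le f\big(d_I(M,N)\big)$$ for all fp modules $M, N \colon \mathbb{R}^n \to \mathrm{vec}_k$ with $d_I(M,N) < \infty$. Moreover, there are sequences $(A_i)_{i\in\mathbb{N}}$ and $(B_i)_{i \in \mathbb{N}}$ of fp modules $\mathbb{R}^n \to \mathrm{vec}_k$ with $d_I(A_i,B_i) \to 0$ as $i \to \infty$ and $\widehat{d_B}(\mathcal{B}(A_i),\mathcal{B}(B_i)) \ge 1$ for all $i$. -/

import Mathlib

open CategoryTheory CategoryTheory.Limits Filter Topology
open scoped NNReal ENNReal ZeroObject

universe u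

noncomputable section

namespace Persistence

/-- `ℝⁿ` as a category has a unique morphism `a ⟶ b` whenever `a ≤ b` in the product order. (This
instance takes precedence over the product category instance of Mathlib.) -/
instance poset_category (n : ℕ) : SmallCategory (Fin n → ℝ) :=
  Preorder.smallCategory (Fin n → ℝ)

/-- Pointwise finite dimensional `n`-parameter persistence modules over `k`: functors from the
poset `ℝⁿ` to finite dimensional `k`-vector spaces. -/
abbrev PersMod (k : Type u) [Field k] (n : ℕ) : Type (u + 1) :=
  (Fin n → ℝ) ⥤ FGModuleCat.{u} k

variable {k : Type u} [Field k] {n : ℕ}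

instance persMod_hasFiniteBiproducts : HasFiniteBiproducts (PersMod k n) :=
  Abelian.hasFiniteBiproducts

instance persMod_hasZeroObject : HasZeroObject (PersMod k n) :=
  Abelian.hasZeroObject

/-- The structure morphism `φ_{a,b} : M(a) → M(b)`, for `a ≤ b`. -/
abbrev structMap (M : PersMod k n) {a b : Fin n → ℝ} (h : a ≤ b) : M.obj a ⟶ M.obj b :=
  M.map (homOfLE h)

/-! ### Interleavings -/

/-- The `v`-shift of a persistence module: `M[v](r) = M(r + v)`. -/
abbrev shift (v : Fin n → ℝ) (M : PersMod k n) : PersMod k n where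
  obj r := M.obj (r + v)
  map f := M.map (homOfLE (add_le_add_left (leOfHom f) v))
  map_id _ := M.map_id _
  map_comp _ _ := M.map_comp _ _

/-- The morphism `M[v] ⟶ N[v]` induced by a morphism `M ⟶ N`. -/
def shiftHom (v : Fin n → ℝ) {M N : PersMod k n} (f : M ⟶ N) : shift v M ⟶ shift v N where
  app r := f.app (r + v)
  naturality _ _ _ := f.naturality _

/-- There is a `(v; w)`-interleaving between `M` and `N`: morphisms `f : M ⟶ N[v]` and
`g : N ⟶ M[w]` such that both composites are given by the structure morphisms. -/
def AreInterleaved (v w : Fin n → ℝ) (hv : 0 ≤ v) (hw : 0 ≤ w) (M N : PersMod k n) : Prop :=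
  ∃ (f : M ⟶ shift v N) (g : N ⟶ shift w M),
    (∀ r : Fin n → ℝ, f.app r ≫ g.app (r + v) =
      structMap M (le_add_of_le_of_nonneg (le_add_of_nonneg_right hv) hw : r ≤ r + v + w)) ∧
    (∀ r : Fin n → ℝ, g.app r ≫ f.app (r + w) =
      structMap N (le_add_of_le_of_nonneg (le_add_of_nonneg_right hw) hv : r ≤ r + w + v))

/-- `M` and `N` are `ε`-interleaved, for a real number `ε ≥ 0`. -/
def Interleaved (ε : ℝ≥0) (M N : PersMod k n) : Prop :=
  AreInterleaved (fun _ => (ε : ℝ)) (fun _ => (ε : ℝ)) (fun _ => ε.2) (fun _ => ε.2) M N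

/-- The interleaving distance; it is `∞` if there is no interleaving. -/
def interleavingDist (M N : PersMod k n) : ℝ≥0∞ :=
  ⨅ (ε : ℝ≥0) (_ : Interleaved ε M N), (ε : ℝ≥0∞)

theorem comp_aux {C : Type*} [Category C] {X X' Y Y' Z Z' : C} (a : X' ⟶ X) (f : X ⟶ Y)
    (e : Y ≅ Y') (g : Y ⟶ Z) (b : Z ⟶ Z') {φ : X ⟶ Z} (h : f ≫ g = φ) :
    (a ≫ f ≫ e.hom) ≫ (e.inv ≫ g ≫ b) = a ≫ φ ≫ b := by
  simp [← h]

theorem Interleaved.of_iso {ε : ℝ≥0} {M M' N N' : PersMod k n} (e : M ≅ M') (e' : N ≅ N')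
    (h : Interleaved ε M N) : Interleaved ε M' N' := by
  obtain ⟨f, g, h1, h2⟩ := h
  refine ⟨e.inv ≫ f ≫ shiftHom _ e'.hom, e'.inv ≫ g ≫ shiftHom _ e.hom, fun r => ?_, fun r => ?_⟩
  · exact (comp_aux (e.inv.app r) (f.app r) (e'.app _) (g.app _) (e.hom.app _) (h1 r)).trans
      (NatIso.naturality_1 e _)
  · exact (comp_aux (e'.inv.app r) (g.app r) (e.app _) (f.app _) (e'.hom.app _) (h2 r)).trans
      (NatIso.naturality_1 e' _)

theorem interleaved_congr {ε : ℝ≥0} {M M' N N' : PersMod k n} (e : M ≅ M') (e' : N ≅ N') :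
    Interleaved ε M N = Interleaved ε M' N' :=
  propext ⟨Interleaved.of_iso e e', Interleaved.of_iso e.symm e'.symm⟩

/-! ### Interval modules and finitely presentable modules -/

/-- The value at `r` of the interval module with support `I`: `k` if `r ∈ I`, and `0` if not. -/
def intervalSpace (k : Type u) [Field k] (I : Set (Fin n → ℝ)) (r : Fin n → ℝ) : Submodule k k :=
  open Classical in if r ∈ I then ⊤ else ⊥

theorem mem_intervalSpace {I : Set (Fin n → ℝ)} {r : Fin n → ℝ} {x : k} :
    x ∈ intervalSpace k I r ↔ r ∉ I → x = 0 := by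
  unfold intervalSpace
  split_ifs with h <;> simp [h]

/-- The structure map of an interval module: the identity of `k` if both points are
in `I`, and zero otherwise. -/
def intervalMap (k : Type u) [Field k] (I : Set (Fin n → ℝ)) (r s : Fin n → ℝ) :
    intervalSpace k I r →ₗ[k] intervalSpace k I s :=
  open Classical in
  if h : s ∈ I then
    (intervalSpace k I r).subtype.codRestrict _ fun _ => mem_intervalSpace.2 fun h' => (h' h).elim
  else 0

theorem coe_intervalMap {I : Set (Fin n → ℝ)} {r s : Fin n → ℝ} (x : intervalSpace k I r) :
    ((intervalMap k I r s x : intervalSpace k I s) : k) =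
      open Classical in if s ∈ I then (x : k) else 0 := by
  unfold intervalMap
  split_ifs with h <;> simp

/-- The interval module with support `I`, for an order-convex subset `I` of `ℝⁿ`. -/
def intervalModule (k : Type u) [Field k] (I : Set (Fin n → ℝ)) (hI : I.OrdConnected) :
    PersMod k n where
  obj r := FGModuleCat.of k (intervalSpace k I r)
  map {r s} _ := FGModuleCat.ofHom (intervalMap k I r s)
  map_id r := by
    apply FGModuleCat.hom_ext
    refine LinearMap.ext fun x => Subtype.ext ?_
    change ((intervalMap k I r r x : intervalSpace k I r) : k) = x
    rw [coe_intervalMap]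
    split_ifs with h
    · rfl
    · exact (mem_intervalSpace.1 x.2 h).symm
  map_comp {r s t} f g := by
    apply FGModuleCat.hom_ext
    refine LinearMap.ext fun x => Subtype.ext ?_
    change ((intervalMap k I r t x : intervalSpace k I t) : k) =
      ((intervalMap k I s t (intervalMap k I r s x) : intervalSpace k I t) : k)
    simp only [coe_intervalMap]
    split_ifs with ht hs
    · rfl
    · refine mem_intervalSpace.1 x.2 fun hr => hs (hI.out hr ht ⟨leOfHom f, leOfHom g⟩)
    · rfl

/-- The indecomposable projective `P_i`, the interval module with support `{j | i ≤ j}`. -/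
def indecProjective (k : Type u) [Field k] (i : Fin n → ℝ) : PersMod k n :=
  intervalModule k (Set.Ici i) Set.ordConnected_Ici

/-- `M` is finitely presentable: it is isomorphic to the cokernel of a morphism between finite
direct sums of indecomposable projectives. -/
def IsFP (M : PersMod k n) : Prop :=
  ∃ (p q : ℕ) (a : Fin p → (Fin n → ℝ)) (b : Fin q → (Fin n → ℝ))
    (f : (⨁ fun i => indecProjective k (a i)) ⟶ (⨁ fun j => indecProjective k (b j))),
    Nonempty (M ≅ cokernel f)

/-- The support `[a₁, b₁) × ⋯ × [aₙ, bₙ)` of a right open rectangle module; the upper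
bounds may be `∞`. -/
def rectangle (a : Fin n → ℝ) (b : Fin n → WithTop ℝ) : Set (Fin n → ℝ) :=
  {r | ∀ i, a i ≤ r i ∧ (r i : WithTop ℝ) < b i}

theorem ordConnected_rectangle (a : Fin n → ℝ) (b : Fin n → WithTop ℝ) :
    (rectangle a b).OrdConnected :=
  ⟨fun _ hx _ hy _ hz i => ⟨(hx i).1.trans (hz.1 i),
    lt_of_le_of_lt (WithTop.coe_le_coe.2 (hz.2 i)) (hy i).2⟩⟩

/-- `M` is (isomorphic to) a right open rectangle module. -/
def IsRectangleModule (M : PersMod k n) : Prop :=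
  ∃ (a : Fin n → ℝ) (b : Fin n → WithTop ℝ), (∀ i, (a i : WithTop ℝ) < b i) ∧
    Nonempty (M ≅ intervalModule k (rectangle a b) (ordConnected_rectangle a b))

/-! ### The rank invariant -/

/-- The rank invariant: the rank of the structure morphism `M(a) → M(b)`, for `a ≤ b`. -/
def rank (M : PersMod k n) {a b : Fin n → ℝ} (h : a ≤ b) : ℤ :=
  (Module.finrank k (LinearMap.range (structMap M h).hom.hom) : ℤ)

theorem rank_eq_of_iso {M N : PersMod k n} (e : M ≅ N) {a b : Fin n → ℝ} (h : a ≤ b) :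
    rank M h = rank N h := by
  unfold rank
  let ea := FGModuleCat.isoToLinearEquiv (e.app a)
  let eb := FGModuleCat.isoToLinearEquiv (e.app b)
  have hn : (structMap N h).hom.hom ∘ₗ ea.toLinearMap =
      eb.toLinearMap ∘ₗ (structMap M h).hom.hom := by
    have := congrArg (fun φ => φ.hom.hom) (e.hom.naturality (homOfLE h))
    exact this.symm
  have hr : LinearMap.range (structMap N h).hom.hom =
      (LinearMap.range (structMap M h).hom.hom).map eb.toLinearMap := by
    rw [← LinearMap.range_comp, ← hn, LinearMap.range_comp_of_range_eq_top]
    exact LinearEquiv.range ea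
  rw [hr]
  exact congrArg _ (LinearEquiv.finrank_map_eq eb _).symm

open Classical in
theorem rank_intervalModule (I : Set (Fin n → ℝ)) (hI : I.OrdConnected) {a b : Fin n → ℝ}
    (h : a ≤ b) :
    rank (intervalModule k I hI) h = if a ∈ I ∧ b ∈ I then 1 else 0 := by
  change ((Module.finrank k (LinearMap.range (intervalMap k I a b)) : ℕ) : ℤ) = _
  split_ifs with hab
  · obtain ⟨ha, hb⟩ := hab
    have hinj : Function.Injective (intervalMap k I a b) := by
      intro x y hxy
      have := congrArg (fun z : intervalSpace k I b => (z : k)) hxy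
      simp only [coe_intervalMap, if_pos hb] at this
      exact Subtype.ext this
    rw [LinearMap.finrank_range_of_inj hinj]
    have : intervalSpace k I a = ⊤ := if_pos ha
    rw [this]; simp
  · have : intervalMap k I a b = 0 := by
      refine LinearMap.ext fun x => Subtype.ext ?_
      rw [coe_intervalMap]
      split_ifs with hb
      · exact mem_intervalSpace.1 x.2 fun ha => hab ⟨ha, hb⟩
      · rfl
    rw [this]; simp

/-! ### Rectangle modules are indecomposable -/

theorem intervalModule_hom_ext {I : Set (Fin n → ℝ)} {hI : I.OrdConnected} {a : Fin n → ℝ}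
    (ha : IsLeast I a) (v : intervalModule k I hI ⟶ intervalModule k I hI)
    (hv : ∀ x : intervalSpace k I a, (v.app a).hom.hom x = 0) : v = 0 := by
  ext r : 2
  apply FGModuleCat.hom_ext
  refine LinearMap.ext fun (x : intervalSpace k I r) => ?_
  change (v.app r).hom.hom x = 0
  by_cases hr : r ∈ I
  · have hx : intervalMap k I a r ⟨x, mem_intervalSpace.2 fun h => (h ha.1).elim⟩ = x :=
      Subtype.ext (by rw [coe_intervalMap, if_pos hr])
    have hn := congrArg (fun φ => φ.hom.hom (⟨x, mem_intervalSpace.2 fun h => (h ha.1).elim⟩ :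
      intervalSpace k I a)) (v.naturality (homOfLE (ha.2 hr)))
    change (v.app r).hom.hom (intervalMap k I a r _) = intervalMap k I a r ((v.app a).hom.hom _) at hn
    rw [hx, hv] at hn
    rw [hn]; exact map_zero _
  · have : x = 0 := Subtype.ext (mem_intervalSpace.1 x.2 hr)
    rw [this]; exact map_zero _

theorem indecomposable_intervalModule {I : Set (Fin n → ℝ)} (hI : I.OrdConnected) {a : Fin n → ℝ}
    (ha : IsLeast I a) : Indecomposable (intervalModule k I hI) := by
  have hone : (1 : k) ∈ intervalSpace k I a := mem_intervalSpace.2 fun h => (h ha.1).elim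
  let o : intervalSpace k I a := ⟨1, hone⟩
  have hspan : ∀ x : intervalSpace k I a, x = (x : k) • o := fun x => Subtype.ext (by simp [o])
  have hext : ∀ v : intervalModule k I hI ⟶ intervalModule k I hI,
      (v.app a).hom.hom o = 0 → v = 0 := by
    intro v hv
    refine intervalModule_hom_ext ha v fun x => ?_
    let L : intervalSpace k I a →ₗ[k] intervalSpace k I a := (v.app a).hom.hom
    have hL : L o = 0 := hv
    change L x = 0
    rw [hspan x, map_smul, hL, smul_zero]
  refine ⟨fun hz => ?_, fun Y Z e => ?_⟩
  · have h0 : 𝟙 (intervalModule k I hI) = 0 := hz.eq_of_src _ _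
    have h1 := congrArg (fun v : intervalModule k I hI ⟶ intervalModule k I hI =>
      (v.app a).hom.hom o) h0
    change o = 0 at h1
    exact one_ne_zero (congrArg Subtype.val h1)
  · let u := e.hom ≫ biprod.fst ≫ biprod.inl ≫ e.inv
    let w := e.hom ≫ biprod.snd ≫ biprod.inr ≫ e.inv
    have huw : u ≫ w = 0 := by simp [u, w]
    by_cases hu : (u.app a).hom.hom o = 0
    · left
      have h0 := hext u hu
      rw [IsZero.iff_id_eq_zero]
      calc 𝟙 Y = biprod.inl ≫ e.inv ≫ u ≫ e.hom ≫ biprod.fst := by simp [u]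
        _ = 0 := by simp [h0]
    · right
      have h0 : w = 0 := by
        apply hext
        have h1 := congrArg (fun v : intervalModule k I hI ⟶ intervalModule k I hI =>
          (v.app a).hom.hom o) huw
        let U : intervalSpace k I a →ₗ[k] intervalSpace k I a := (u.app a).hom.hom
        let W : intervalSpace k I a →ₗ[k] intervalSpace k I a := (w.app a).hom.hom
        change W (U o) = 0 at h1
        have hc : ((U o : intervalSpace k I a) : k) ≠ 0 := fun h => hu (Subtype.ext h)
        rw [hspan (U o), map_smul] at h1
        exact (smul_eq_zero.1 h1).resolve_left hc
      rw [IsZero.iff_id_eq_zero]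
      calc 𝟙 Z = biprod.inr ≫ e.inv ≫ w ≫ e.hom ≫ biprod.snd := by simp [w]
        _ = 0 := by simp [h0]

/-- Right open rectangle modules are indecomposable, hence define bars. -/
theorem indecomposable_rectangle {a : Fin n → ℝ} {b : Fin n → WithTop ℝ}
    (hab : ∀ i, (a i : WithTop ℝ) < b i) :
    Indecomposable (intervalModule k (rectangle a b) (ordConnected_rectangle a b)) :=
  indecomposable_intervalModule _ (a := a) ⟨fun i => ⟨le_rfl, hab i⟩, fun _ hr i => (hr i).1⟩

/-! ### Barcodes and signed barcodes -/

/-- Isomorphism of indecomposable persistence modules. -/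
def barSetoid (k : Type u) [Field k] (n : ℕ) :
    Setoid {M : PersMod k n // Indecomposable M} where
  r M N := Nonempty (M.1 ≅ N.1)
  iseqv := ⟨fun M => ⟨Iso.refl M.1⟩, fun ⟨e⟩ => ⟨e.symm⟩, fun ⟨e⟩ ⟨e'⟩ => ⟨e ≪≫ e'⟩⟩

/-- The type of bars: isomorphism classes of indecomposable persistence modules. -/
def Bar (k : Type u) [Field k] (n : ℕ) : Type (u + 1) :=
  Quotient (barSetoid k n)

namespace Bar

/-- The isomorphism class of an indecomposable module. -/
def mk (M : PersMod k n) (hM : Indecomposable M) : Bar k n :=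
  Quotient.mk (barSetoid k n) ⟨M, hM⟩

/-- The rank invariant of (any representative of) a bar. -/
def rank {a b : Fin n → ℝ} (h : a ≤ b) (c : Bar k n) : ℤ :=
  Quotient.lift (s := barSetoid k n) (fun M => Persistence.rank M.1 h)
    (fun _ _ he => rank_eq_of_iso (Nonempty.some he) h) c

/-- (Any representatives of) two bars are `ε`-interleaved. -/
def Interleaved (ε : ℝ≥0) (c d : Bar k n) : Prop :=
  Quotient.lift₂ (s₁ := barSetoid k n) (s₂ := barSetoid k n)
    (fun M N => Persistence.Interleaved ε M.1 N.1)
    (fun _ _ _ _ he he' => interleaved_congr (Nonempty.some he) (Nonempty.some he')) c d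

/-- (Any representative of) a bar is `ε`-interleaved with the zero module. -/
def InterleavedZero (ε : ℝ≥0) (c : Bar k n) : Prop :=
  Quotient.lift (s := barSetoid k n) (fun M => Persistence.Interleaved ε M.1 (0 : PersMod k n))
    (fun _ _ he => interleaved_congr (Nonempty.some he) (Iso.refl _)) c

/-- The bar is the isomorphism class of a right open rectangle module. -/
def IsRectangle (c : Bar k n) : Prop :=
  ∃ (M : PersMod k n) (hM : Indecomposable M), IsRectangleModule M ∧ c = mk M hM

end Bar

/-- A (finite) barcode: a multiset of isomorphism classes of indecomposable modules. -/
abbrev Barcode (k : Type u) [Field k] (n : ℕ) : Type (u + 1) :=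
  Multiset (Bar k n)

/-- A (finite) signed barcode: an ordered pair of barcodes. -/
@[ext]
structure SignedBarcode (k : Type u) [Field k] (n : ℕ) : Type (u + 1) where
  pos : Barcode k n
  neg : Barcode k n

/-! ### Matchings, bottleneck distance, signed bottleneck dissimilarity -/

open Classical in
/-- There is an `ε`-matching between the barcodes `C` and `D`: a partial bijection `h` between
their index sets (a bar of multiplicity `m` gives `m` indices) such that matched bars
are `ε`-interleaved, and unmatched bars are `ε`-interleaved with the zero module. -/
def HasMatching (ε : ℝ≥0) (C D : Barcode k n) : Prop :=
  ∃ h : C.ToType ≃. D.ToType,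
    (∀ i j, h i = some j → Bar.Interleaved ε i.1 j.1) ∧
    (∀ i, h i = none → Bar.InterleavedZero ε i.1) ∧
    (∀ j, h.symm j = none → Bar.InterleavedZero ε j.1)

/-- The bottleneck distance; it is `∞` if there is no matching. -/
def bottleneckDist (C D : Barcode k n) : ℝ≥0∞ :=
  ⨅ (ε : ℝ≥0) (_ : HasMatching ε C D), (ε : ℝ≥0∞)

/-- The signed bottleneck dissimilarity `d_B(C₊ ∪ D₋, D₊ ∪ C₋)`; the union `∪` of multisets
adds multiplicities. -/
def signedBottleneckDissim (C D : SignedBarcode k n) : ℝ≥0∞ :=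
  bottleneckDist (C.pos + D.neg) (D.pos + C.neg)

/-! ### Rank decompositions -/

/-- The signed barcode `C` is a rank decomposition of `M`. -/
def IsRankDecomposition (M : PersMod k n) (C : SignedBarcode k n) : Prop :=
  ∀ (a b : Fin n → ℝ) (h : a ≤ b),
    rank M h = (C.pos.map (Bar.rank h)).sum - (C.neg.map (Bar.rank h)).sum

/-- `C` is the minimal rank decomposition by rectangles of `M`. -/
structure IsMinimalRankDecompositionByRectangles (M : PersMod k n) (C : SignedBarcode k n) :
    Prop where
  pos_isRectangle : ∀ c ∈ C.pos, Bar.IsRectangle c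
  neg_isRectangle : ∀ c ∈ C.neg, Bar.IsRectangle c
  disjoint : Disjoint C.pos C.neg
  isRankDecomposition : IsRankDecomposition M C

theorem exists_coord (S : List (WithTop ℝ)) (a : ℝ) (b : WithTop ℝ) (hab : (a : WithTop ℝ) < b) :
    ∃ t : ℝ, a ≤ t ∧ (t : WithTop ℝ) < b ∧ ∀ c ∈ S, (t : WithTop ℝ) < c → b ≤ c := by
  induction S with
  | nil => exact ⟨a, le_rfl, hab, by simp⟩
  | cons c S ih =>
    obtain ⟨t, h1, h2, h3⟩ := ih
    by_cases hc : c < b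
    · lift c to ℝ using (lt_of_lt_of_le hc le_top).ne
      refine ⟨max t c, h1.trans (le_max_left _ _), ?_, ?_⟩
      · rcases max_choice t c with h | h <;> rw [h] <;> assumption
      · intro d hd hlt
        rcases List.mem_cons.1 hd with rfl | hd
        · exact absurd (WithTop.coe_lt_coe.1 hlt) (not_lt.2 (le_max_right _ _))
        · exact h3 d hd (lt_of_le_of_lt (WithTop.coe_le_coe.2 (le_max_left _ _)) hlt)
    · refine ⟨t, h1, h2, fun d hd hlt => ?_⟩
      rcases List.mem_cons.1 hd with rfl | hd
      · exact not_lt.1 hc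
      · exact h3 d hd hlt

/-- A barcode of right open rectangle modules is determined by its rank invariant. -/
theorem barcode_eq_of_rank_eq (X Y : Barcode k n) (hX : ∀ c ∈ X, Bar.IsRectangle c)
    (hY : ∀ c ∈ Y, Bar.IsRectangle c)
    (h : ∀ (a b : Fin n → ℝ) (h : a ≤ b), (X.map (Bar.rank h)).sum = (Y.map (Bar.rank h)).sum) :
    X = Y := by
  classical
  by_contra hne
  -- choose the endpoints
  have hex : ∀ c : Bar k n, ∃ p : (Fin n → ℝ) × (Fin n → WithTop ℝ), Bar.IsRectangle c →
      (∀ i, (p.1 i : WithTop ℝ) < p.2 i) ∧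
      ∃ hi : Indecomposable (intervalModule k (rectangle p.1 p.2) (ordConnected_rectangle p.1 p.2)),
        c = Bar.mk _ hi := by
    intro c
    by_cases hc : Bar.IsRectangle c
    · obtain ⟨M, hM, ⟨a, b, hab, ⟨e⟩⟩, rfl⟩ := hc
      refine ⟨(a, b), fun _ => ⟨hab, ?_, ?_⟩⟩
      · refine ⟨fun hz => hM.1 (hz.of_iso e), fun Y Z i => hM.2 Y Z (e ≪≫ i)⟩
      · exact Quotient.sound (s := barSetoid k n) ⟨e⟩
    · exact ⟨(0, 0), fun h => absurd h hc⟩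
  choose p hp using hex
  have hrank : ∀ c, Bar.IsRectangle c → ∀ (s t : Fin n → ℝ) (hst : s ≤ t), Bar.rank hst c =
      if s ∈ rectangle (p c).1 (p c).2 ∧ t ∈ rectangle (p c).1 (p c).2 then 1 else 0 := by
    intro c hc s t hst
    obtain ⟨_, hi, he⟩ := hp c hc
    have : Bar.rank hst c = Bar.rank hst (Bar.mk _ hi) := congrArg _ he
    rw [this]
    exact rank_intervalModule _ (ordConnected_rectangle _ _) hst
  have hinj : ∀ c d, Bar.IsRectangle c → Bar.IsRectangle d → p c = p d → c = d := by
    intro c d hc hd hcd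
    obtain ⟨_, hi, he⟩ := hp c hc
    obtain ⟨_, hi', he'⟩ := hp d hd
    rw [he, he']
    generalize p c = q at *
    subst hcd
    rfl
  let S : Finset (Bar k n) := (X - Y + (Y - X)).toFinset
  have hS : ∀ c ∈ S, Bar.IsRectangle c := by
    intro c hc
    rw [Multiset.mem_toFinset, Multiset.mem_add] at hc
    rcases hc with hc | hc
    · exact hX c (Multiset.mem_of_le (Multiset.sub_le_self _ _) hc)
    · exact hY c (Multiset.mem_of_le (Multiset.sub_le_self _ _) hc)
  have hSne : S.Nonempty := by
    rw [Finset.nonempty_iff_ne_empty]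
    intro h0
    have h0' : X - Y + (Y - X) = 0 := Multiset.toFinset_eq_empty.1 h0
    rw [add_eq_zero] at h0'
    exact hne (le_antisymm (tsub_eq_zero_iff_le.1 h0'.1) (tsub_eq_zero_iff_le.1 h0'.2))
  obtain ⟨c0, hc0, hmin⟩ := S.exists_minimalFor (fun c => (p c).1) hSne
  obtain ⟨c, hc, hmax⟩ := (S.filter fun c => (p c).1 = (p c0).1).exists_maximalFor
    (fun c => (p c).2) ⟨c0, by simp [hc0]⟩
  simp only [Finset.mem_filter] at hc hmax
  have hlt := (hp c (hS c hc.1)).1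
  choose t ht1 ht2 ht3 using fun i =>
    exists_coord (S.toList.map fun d => (p d).2 i) ((p c).1 i) ((p c).2 i) (hlt i)
  have key : ∀ d ∈ S, Bar.rank (show (p c).1 ≤ t from ht1) d = if d = c then 1 else 0 := by
    intro d hd
    rw [hrank d (hS d hd)]
    by_cases hdc : d = c
    · subst hdc
      rw [if_pos rfl, if_pos]
      exact ⟨fun i => ⟨le_rfl, hlt i⟩, fun i => ⟨ht1 i, ht2 i⟩⟩
    · rw [if_neg hdc, if_neg]
      rintro ⟨h1, h2⟩
      have e1 : (p d).1 ≤ (p c0).1 := hc.2 ▸ fun i => (h1 i).1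
      have e2 : (p d).1 = (p c0).1 := le_antisymm e1 (hmin hd e1)
      have e3 : (p c).2 ≤ (p d).2 := fun i =>
        ht3 i _ (List.mem_map.2 ⟨d, Finset.mem_toList.2 hd, rfl⟩) (h2 i).2
      have e4 := hmax ⟨hd, e2⟩ e3
      exact hdc (hinj d c (hS d hd) (hS c hc.1) (Prod.ext (e2.trans hc.2.symm) (le_antisymm e4 e3)))
  have hcount : ∀ Z : Barcode k n, (∀ d ∈ Z, d ∈ S) →
      (Z.map (Bar.rank (show (p c).1 ≤ t from ht1))).sum = Z.count c := by
    intro Z hZ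
    rw [Multiset.map_congr rfl fun d hd => key d (hZ d hd)]
    clear hZ
    induction Z using Multiset.induction_on with
    | empty => simp
    | cons d Z ih =>
      rw [Multiset.map_cons, Multiset.sum_cons, ih, Multiset.count_cons]
      by_cases hdc : d = c
      · subst hdc; simp; ring
      · simp [hdc, Ne.symm hdc]
  have h1 := hcount (X - Y) fun d hd => Multiset.mem_toFinset.2 (Multiset.mem_add.2 (Or.inl hd))
  have h2 := hcount (Y - X) fun d hd => Multiset.mem_toFinset.2 (Multiset.mem_add.2 (Or.inr hd))
  have hXY : X - Y + Y = Y - X + X := by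
    ext d; simp only [Multiset.count_add, Multiset.count_sub]; omega
  have h3 := congrArg (fun Z : Barcode k n => (Z.map (Bar.rank (show (p c).1 ≤ t from ht1))).sum) hXY
  simp only [Multiset.map_add, Multiset.sum_add, h1, h2] at h3
  rw [h _ _ _] at h3
  have h4 : (X - Y).count c = (Y - X).count c := by exact_mod_cast add_right_cancel h3
  have h5 : c ∈ X - Y + (Y - X) := Multiset.mem_toFinset.1 hc.1
  rw [← Multiset.count_pos, Multiset.count_add] at h5
  simp only [Multiset.count_sub] at h4 h5
  omega

/-- A module has at most one minimal rank decomposition by rectangles. -/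
theorem IsMinimalRankDecompositionByRectangles.unique {M : PersMod k n} {C D : SignedBarcode k n}
    (hC : IsMinimalRankDecompositionByRectangles M C)
    (hD : IsMinimalRankDecompositionByRectangles M D) : C = D := by
  classical
  have h : C.pos + D.neg = D.pos + C.neg := by
    refine barcode_eq_of_rank_eq _ _ ?_ ?_ ?_
    · intro c hc
      exact (Multiset.mem_add.1 hc).elim (hC.pos_isRectangle c) (hD.neg_isRectangle c)
    · intro c hc
      exact (Multiset.mem_add.1 hc).elim (hD.pos_isRectangle c) (hC.neg_isRectangle c)
    · intro a b hab
      have h1 := hC.isRankDecomposition a b hab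
      have h2 := hD.isRankDecomposition a b hab
      simp only [Multiset.map_add, Multiset.sum_add]
      linarith
  have hcd : ∀ (E : SignedBarcode k n), Disjoint E.pos E.neg → ∀ c, E.pos.count c = 0 ∨ E.neg.count c = 0 := by
    intro E hE c
    by_contra! hh
    exact Multiset.disjoint_left.1 hE (Multiset.count_ne_zero.1 hh.1) (Multiset.count_ne_zero.1 hh.2)
  have hc : ∀ c, C.pos.count c = D.pos.count c ∧ C.neg.count c = D.neg.count c := by
    intro c
    have := congrArg (Multiset.count c) h
    simp only [Multiset.count_add] at this
    have := hcd C hC.disjoint c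
    have := hcd D hD.disjoint c
    omega
  exact SignedBarcode.ext (Multiset.ext.2 fun c => (hc c).1) (Multiset.ext.2 fun c => (hc c).2)

end Persistence

end

/-!
The counterexample lives in the first two coordinates; a point `(x, y)` below stands for
`(x, y, 0, …, 0)`. Write `P_p` for the indecomposable projective generated at `p`, and let
`ε = 1 / N`. Consider

* `chainModule`: `P_(1, 0) ⊕ ⨁_{j < N} P_(jε, -1)`;
* `stepModule`: `P_(1, 0) ⊕ ⨁_{j < N} U_j`, where `U_j` is the interval module of the upper set
  generated by `((j + 1)ε, -1)` and `(jε, 0)`.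

The support of `U_j` lies in that of `P_(jε, -1)` and contains its translate by `ε`, so the two
modules are `ε`-interleaved summand by summand (`interleaved_chainModule_stepModule`). By
inclusion–exclusion, the rank invariant of `U_j` is that of
`P_((j + 1)ε, -1) ⊕ P_(jε, 0)` minus that of `P_((j + 1)ε, 0)`. The negative term is cancelled by a
positive term of the next summand, and the last one by `P_(1, 0)`, so the minimal rank decomposition
of `stepModule` consists of the positive bars `(jε, -1)`, `1 ≤ j ≤ N`, and `(0, 0)`
(`rank_stepModule`). The bar `P_(0, 0)` is at distance at least `1` from every bar
of `chainModule` and at infinite distance from zero, hence the dissimilarity is at least `1`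
(`one_le_signedBottleneckDissim`): the cancellation has moved a bar from `(1, 0)` to `(0, 0)`
through many short steps.

No value of `f` at `0` is prescribed by its limit at `0`, so a bound by `f` is contradicted only
because the interleaving distance, which is exactly `ε`, is positive
(`interleavingDist_chainModule_stepModule`).
-/

noncomputable section

namespace Persistence

variable {k : Type u} [Field k] {n : ℕ}

/-! ### Interval modules of upper sets -/

/-- The linear map `k_I(r) → k_J(s)` between values of two interval modules that is the identity
of `k` wherever both sides are nonzero. -/
def intervalCompare (k : Type u) [Field k] (I J : Set (Fin n → ℝ)) (r s : Fin n → ℝ) :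
    intervalSpace k I r →ₗ[k] intervalSpace k J s :=
  open Classical in
  if h : s ∈ J then
    (intervalSpace k I r).subtype.codRestrict _ fun _ => mem_intervalSpace.2 fun h' => (h' h).elim
  else 0

theorem coe_intervalCompare {I J : Set (Fin n → ℝ)} {r s : Fin n → ℝ} (x : intervalSpace k I r) :
    ((intervalCompare k I J r s x : intervalSpace k J s) : k) =
      open Classical in if s ∈ J then (x : k) else 0 := by
  unfold intervalCompare
  split_ifs with h <;> simp

theorem coe_intervalCompare_of_imp {I J : Set (Fin n → ℝ)} {r s : Fin n → ℝ} (h : r ∈ I → s ∈ J)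
    (x : intervalSpace k I r) :
    ((intervalCompare k I J r s x : intervalSpace k J s) : k) = x := by
  rw [coe_intervalCompare]
  split_ifs with hs
  · rfl
  · exact (mem_intervalSpace.1 x.2 fun hr => hs (h hr)).symm

theorem coe_intervalMap_of_isUpperSet {I : Set (Fin n → ℝ)} (hI : IsUpperSet I)
    {r s : Fin n → ℝ} (h : r ≤ s) (x : intervalSpace k I r) :
    ((intervalMap k I r s x : intervalSpace k I s) : k) = x := by
  rw [coe_intervalMap]
  split_ifs with hs
  · rfl
  · exact (mem_intervalSpace.1 x.2 fun hr => hs (hI h hr)).symm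

/-- The interval module whose support is an upper set. -/
def upperModule (k : Type u) [Field k] (I : UpperSet (Fin n → ℝ)) : PersMod k n :=
  intervalModule k I I.upper.ordConnected

/-- If `I + v ⊆ J`, the interval module of `I` is contained in the `v`-shift of that of `J`. -/
def upperShiftHom (k : Type u) [Field k] (I J : UpperSet (Fin n → ℝ)) (v : Fin n → ℝ)
    (h : ∀ r ∈ I, r + v ∈ J) : upperModule k I ⟶ shift v (upperModule k J) where
  app r := FGModuleCat.ofHom (intervalCompare k I J r (r + v))
  naturality r s f := by
    apply FGModuleCat.hom_ext
    refine LinearMap.ext fun (x : intervalSpace k (I : Set (Fin n → ℝ)) r) => ?_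
    refine Subtype.ext (?_ : _ = (_ : k))
    change ((intervalCompare k I J s (s + v) (intervalMap k I r s x)
        : intervalSpace k (J : Set (Fin n → ℝ)) (s + v)) : k) =
      ((intervalMap k J (r + v) (s + v) (intervalCompare k I J r (r + v) x)
        : intervalSpace k (J : Set (Fin n → ℝ)) (s + v)) : k)
    rw [coe_intervalCompare_of_imp (h s), coe_intervalMap_of_isUpperSet I.upper (leOfHom f),
      coe_intervalMap_of_isUpperSet J.upper (add_le_add_left (leOfHom f) v),
      coe_intervalCompare_of_imp (h r)]

/-- The inclusion of interval modules of upper sets `I ⊆ J`. -/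
def upperHom (k : Type u) [Field k] (I J : UpperSet (Fin n → ℝ)) (h : ∀ r ∈ I, r ∈ J) :
    upperModule k I ⟶ upperModule k J where
  app r := FGModuleCat.ofHom (intervalCompare k I J r r)
  naturality r s f := by
    apply FGModuleCat.hom_ext
    refine LinearMap.ext fun (x : intervalSpace k (I : Set (Fin n → ℝ)) r) => ?_
    refine Subtype.ext (?_ : _ = (_ : k))
    change ((intervalCompare k I J s s (intervalMap k I r s x)
        : intervalSpace k (J : Set (Fin n → ℝ)) s) : k) =
      ((intervalMap k J r s (intervalCompare k I J r r x)
        : intervalSpace k (J : Set (Fin n → ℝ)) s) : k)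
    rw [coe_intervalCompare_of_imp (h s), coe_intervalMap_of_isUpperSet I.upper (leOfHom f),
      coe_intervalMap_of_isUpperSet J.upper (leOfHom f),
      coe_intervalCompare_of_imp (h r)]

open Classical in
theorem rank_upperModule (I : UpperSet (Fin n → ℝ)) {a b : Fin n → ℝ} (h : a ≤ b) :
    rank (upperModule k I) h = if a ∈ I then 1 else 0 := by
  unfold upperModule
  rw [rank_intervalModule]
  refine if_congr ⟨And.left, fun ha => ⟨ha, I.upper h ha⟩⟩ rfl rfl

theorem interleaved_upperModule {ε : ℝ≥0} {I J : UpperSet (Fin n → ℝ)}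
    (hIJ : ∀ r ∈ I, r + (fun _ => (ε : ℝ)) ∈ J) (hJI : ∀ r ∈ J, r + (fun _ => (ε : ℝ)) ∈ I) :
    Interleaved ε (upperModule k I) (upperModule k J) := by
  have key : ∀ {I J : UpperSet (Fin n → ℝ)} (hIJ : ∀ r ∈ I, r + (fun _ => (ε : ℝ)) ∈ J)
      (hJI : ∀ r ∈ J, r + (fun _ => (ε : ℝ)) ∈ I) (r : Fin n → ℝ)
      (h : r ≤ r + (fun _ => (ε : ℝ)) + (fun _ => (ε : ℝ))),
      (upperShiftHom k I J _ hIJ).app r ≫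
        (upperShiftHom k J I _ hJI).app (r + fun _ => (ε : ℝ)) =
        structMap (upperModule k I) h := by
    intro I J hIJ hJI r h
    apply FGModuleCat.hom_ext
    refine LinearMap.ext fun (x : intervalSpace k (I : Set (Fin n → ℝ)) r) => ?_
    refine Subtype.ext (?_ : _ = (_ : k))
    change ((intervalCompare k J I (r + _) (r + _ + _) (intervalCompare k I J r (r + _) x)
        : intervalSpace k (I : Set (Fin n → ℝ)) _) : k) =
      ((intervalMap k I r (r + _ + _) x : intervalSpace k (I : Set (Fin n → ℝ)) _) : k)
    rw [coe_intervalCompare_of_imp (hJI _), coe_intervalCompare_of_imp (hIJ r),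
      coe_intervalMap_of_isUpperSet I.upper h]
  exact ⟨upperShiftHom k I J _ hIJ, upperShiftHom k J I _ hJI, fun r => key hIJ hJI r _,
    fun r => key hJI hIJ r _⟩

/-! ### Direct sums -/

/-- The direct sum of two persistence modules, with the product of vector spaces at each point. -/
def dsum (M N : PersMod k n) : PersMod k n where
  obj r := FGModuleCat.of k (M.obj r × N.obj r)
  map f := FGModuleCat.ofHom ((M.map f).hom.hom.prodMap (N.map f).hom.hom)
  map_id r := by
    apply FGModuleCat.hom_ext
    rw [M.map_id, N.map_id]
    rfl
  map_comp f g := by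
    apply FGModuleCat.hom_ext
    rw [M.map_comp, N.map_comp]
    rfl

theorem rank_dsum (M N : PersMod k n) {a b : Fin n → ℝ} (h : a ≤ b) :
    rank (dsum M N) h = rank M h + rank N h := by
  let f : M.obj a →ₗ[k] M.obj b := (structMap M h).hom.hom
  let g : N.obj a →ₗ[k] N.obj b := (structMap N h).hom.hom
  change ((Module.finrank k (LinearMap.range (f.prodMap g)) : ℕ) : ℤ) =
    (Module.finrank k (LinearMap.range f) : ℤ) + (Module.finrank k (LinearMap.range g) : ℤ)
  let e : ((LinearMap.range f).prod (LinearMap.range g)) ≃ₗ[k]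
      LinearMap.range f × LinearMap.range g :=
    { toFun := fun x => (⟨x.1.1, x.2.1⟩, ⟨x.1.2, x.2.2⟩)
      invFun := fun x => ⟨(x.1.1, x.2.1), x.1.2, x.2.2⟩
      map_add' := fun _ _ => rfl
      map_smul' := fun _ _ => rfl }
  rw [LinearMap.range_prodMap, e.finrank_eq, Module.finrank_prod]
  push_cast
  rfl

/-- The morphism between direct sums induced by a pair of morphisms into shifts. -/
def dsumShiftHom (v : Fin n → ℝ) {M N M' N' : PersMod k n} (f : M ⟶ shift v M')
    (g : N ⟶ shift v N') : dsum M N ⟶ shift v (dsum M' N') where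
  app r := FGModuleCat.ofHom
    (LinearMap.prodMap (M₃ := M'.obj (r + v)) (M₄ := N'.obj (r + v))
      (f.app r).hom.hom (g.app r).hom.hom)
  naturality r s φ := by
    apply FGModuleCat.hom_ext
    refine LinearMap.ext fun (x : M.obj r × N.obj r) => ?_
    exact Prod.ext (congrArg (fun ψ => ψ.hom.hom x.1) (f.naturality φ))
      (congrArg (fun ψ => ψ.hom.hom x.2) (g.naturality φ))

theorem Interleaved.dsum {ε : ℝ≥0} {M N M' N' : PersMod k n} (h : Interleaved ε M M')
    (h' : Interleaved ε N N') : Interleaved ε (dsum M N) (dsum M' N') := by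
  obtain ⟨f, g, h1, h2⟩ := h
  obtain ⟨f', g', h1', h2'⟩ := h'
  refine ⟨dsumShiftHom _ f f', dsumShiftHom _ g g', fun r => ?_, fun r => ?_⟩
  · apply FGModuleCat.hom_ext
    refine LinearMap.ext fun (x : M.obj r × N.obj r) => ?_
    exact Prod.ext (congrArg (fun ψ => ψ.hom.hom x.1) (h1 r))
      (congrArg (fun ψ => ψ.hom.hom x.2) (h1' r))
  · apply FGModuleCat.hom_ext
    refine LinearMap.ext fun (x : M'.obj r × N'.obj r) => ?_
    exact Prod.ext (congrArg (fun ψ => ψ.hom.hom x.1) (h2 r))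
      (congrArg (fun ψ => ψ.hom.hom x.2) (h2' r))

/-- The pointwise direct sum is a biproduct. -/
def dsumIsoBiprod (M N : PersMod k n) : dsum M N ≅ M ⊞ N :=
  biprod.uniqueUpToIso M N (b :=
    { pt := dsum M N
      fst :=
        { app := fun r => FGModuleCat.ofHom (LinearMap.fst k (M.obj r) (N.obj r))
          naturality := fun _ _ _ => rfl }
      snd :=
        { app := fun r => FGModuleCat.ofHom (LinearMap.snd k (M.obj r) (N.obj r))
          naturality := fun _ _ _ => rfl }
      inl :=
        { app := fun r => FGModuleCat.ofHom (LinearMap.inl k (M.obj r) (N.obj r))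
          naturality := fun r s f => by
            apply FGModuleCat.hom_ext
            refine LinearMap.ext fun (x : M.obj r) => ?_
            exact Prod.ext rfl (map_zero (N.map f).hom.hom).symm }
      inr :=
        { app := fun r => FGModuleCat.ofHom (LinearMap.inr k (M.obj r) (N.obj r))
          naturality := fun r s f => by
            apply FGModuleCat.hom_ext
            refine LinearMap.ext fun (x : N.obj r) => ?_
            exact Prod.ext (map_zero (M.map f).hom.hom).symm rfl }
      inl_fst := rfl
      inl_snd := rfl
      inr_fst := rfl
      inr_snd := rfl }) (isBinaryBilimitOfTotal _ (by
    ext r : 2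
    apply FGModuleCat.hom_ext
    refine LinearMap.ext fun (x : M.obj r × N.obj r) => ?_
    exact Prod.ext (add_zero x.1) (zero_add x.2)))

/-- The direct sum `X ⊕ F 0 ⊕ ⋯ ⊕ F (m - 1)`. -/
def iteratedSum (X : PersMod k n) (F : ℕ → PersMod k n) : ℕ → PersMod k n
  | 0 => X
  | m + 1 => dsum (iteratedSum X F m) (F m)

theorem rank_iteratedSum (X : PersMod k n) (F : ℕ → PersMod k n) (m : ℕ) {a b : Fin n → ℝ}
    (h : a ≤ b) :
    rank (iteratedSum X F m) h = rank X h + ∑ j ∈ Finset.range m, rank (F j) h := by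
  induction m with
  | zero => simp [iteratedSum]
  | succ m ih => rw [iteratedSum, rank_dsum, ih, Finset.sum_range_succ, add_assoc]

theorem Interleaved.iteratedSum {ε : ℝ≥0} {X Y : PersMod k n} {F G : ℕ → PersMod k n}
    (h : Interleaved ε X Y) (m : ℕ) (h' : ∀ j < m, Interleaved ε (F j) (G j)) :
    Interleaved ε (iteratedSum X F m) (iteratedSum Y G m) := by
  induction m with
  | zero => exact h
  | succ m ih => exact (ih fun j hj => h' j (hj.trans m.lt_succ_self)).dsum (h' m m.lt_succ_self)

/-! ### Finite presentations -/

/-- `X` is isomorphic to a finite direct sum of indecomposable projectives. -/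
def IsFreeSum (X : PersMod k n) : Prop :=
  ∃ (p : ℕ) (a : Fin p → (Fin n → ℝ)), Nonempty (X ≅ ⨁ fun i => indecProjective k (a i))

theorem IsFreeSum.indecProjective (a : Fin n → ℝ) : IsFreeSum (indecProjective k a) :=
  ⟨1, fun _ => a, ⟨(biproductUniqueIso fun _ : Fin 1 => Persistence.indecProjective k a).symm⟩⟩

theorem isFreeSum_zero : IsFreeSum (0 : PersMod k n) :=
  ⟨0, Fin.elim0, ⟨(isZero_zero _).iso ((IsZero.iff_id_eq_zero _).2
    (biproduct.hom_ext _ _ fun j => j.elim0))⟩⟩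

/-- A biproduct over `Fin (p + q)` of a concatenated family. -/
def biproductFinAppendIso {C : Type*} [Category C] [Preadditive C] [HasFiniteBiproducts C]
    [HasBinaryBiproducts C] {p q : ℕ} (F : Fin (p + q) → C) :
    ((⨁ fun i => F (Fin.castAdd q i)) ⊞ (⨁ fun i => F (Fin.natAdd p i))) ≅ ⨁ F where
  hom := biprod.desc (biproduct.desc fun i => biproduct.ι F (Fin.castAdd q i))
    (biproduct.desc fun i => biproduct.ι F (Fin.natAdd p i))
  inv := biproduct.desc fun i => Fin.addCases (motive := fun i => F i ⟶ _)
    (fun i => biproduct.ι (fun i => F (Fin.castAdd q i)) i ≫ biprod.inl)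
    (fun i => biproduct.ι (fun i => F (Fin.natAdd p i)) i ≫ biprod.inr) i
  hom_inv_id := by
    apply biprod.hom_ext' <;> refine biproduct.hom_ext' _ _ fun j => ?_ <;> simp
  inv_hom_id := by
    refine biproduct.hom_ext' _ _ fun j => ?_
    refine Fin.addCases (fun i => ?_) (fun i => ?_) j <;> simp

theorem IsFreeSum.biprod {X Y : PersMod k n} (hX : IsFreeSum X) (hY : IsFreeSum Y) :
    IsFreeSum (X ⊞ Y) := by
  obtain ⟨p, a, ⟨e⟩⟩ := hX
  obtain ⟨q, b, ⟨e'⟩⟩ := hY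
  refine ⟨p + q, Fin.append a b, ⟨?_⟩⟩
  let F (i : Fin (p + q)) := Persistence.indecProjective k (Fin.append a b i)
  have el : (⨁ fun i => Persistence.indecProjective k (a i)) ≅ ⨁ fun i => F (Fin.castAdd q i) :=
    biproduct.mapIso fun i => eqToIso (by simp [F])
  have er : (⨁ fun i => Persistence.indecProjective k (b i)) ≅ ⨁ fun i => F (Fin.natAdd p i) :=
    biproduct.mapIso fun i => eqToIso (by simp [F])
  exact biprod.mapIso (e ≪≫ el) (e' ≪≫ er) ≪≫ biproductFinAppendIso F

theorem isFP_iff (M : PersMod k n) : IsFP M ↔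
    ∃ (X Y : PersMod k n) (_ : IsFreeSum X) (_ : IsFreeSum Y) (f : X ⟶ Y),
      Nonempty (M ≅ cokernel f) := by
  constructor
  · rintro ⟨p, q, a, b, f, h⟩
    exact ⟨_, _, ⟨p, a, ⟨Iso.refl _⟩⟩, ⟨q, b, ⟨Iso.refl _⟩⟩, f, h⟩
  · rintro ⟨X, Y, ⟨p, a, ⟨e⟩⟩, ⟨q, b, ⟨e'⟩⟩, f, ⟨h⟩⟩
    exact ⟨p, q, a, b, e.inv ≫ f ≫ e'.hom,
      ⟨h ≪≫ cokernel.mapIso _ _ e e' (by simp)⟩⟩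

theorem IsFP.indecProjective (a : Fin n → ℝ) : IsFP (indecProjective k a) :=
  (isFP_iff _).2 ⟨0, _, isFreeSum_zero, .indecProjective a, 0, ⟨cokernelZeroIsoTarget.symm⟩⟩

/-- The cokernel of a direct sum of two morphisms. -/
def cokernelBiprodMapIso {C : Type*} [Category C] [Preadditive C] [HasBinaryBiproducts C]
    [HasCokernels C] {X Y X' Y' : C} (f : X ⟶ Y) (g : X' ⟶ Y') :
    cokernel (biprod.map f g) ≅ cokernel f ⊞ cokernel g where
  hom := cokernel.desc _ (biprod.map (cokernel.π f) (cokernel.π g)) (by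
    apply biprod.hom_ext' <;> simp)
  inv := biprod.desc
    (cokernel.desc _ (biprod.inl ≫ cokernel.π (biprod.map f g)) (by
      rw [← biprod.inl_map_assoc, cokernel.condition, comp_zero]))
    (cokernel.desc _ (biprod.inr ≫ cokernel.π (biprod.map f g)) (by
      rw [← biprod.inr_map_assoc, cokernel.condition, comp_zero]))
  hom_inv_id := by
    apply coequalizer.hom_ext
    apply biprod.hom_ext' <;> simp
  inv_hom_id := by
    apply biprod.hom_ext' <;> apply coequalizer.hom_ext <;> simp

theorem IsFP.dsum {M N : PersMod k n} (hM : IsFP M) (hN : IsFP N) : IsFP (dsum M N) := by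
  rw [isFP_iff] at *
  obtain ⟨X, Y, hX, hY, f, ⟨e⟩⟩ := hM
  obtain ⟨X', Y', hX', hY', g, ⟨e'⟩⟩ := hN
  exact ⟨_, _, hX.biprod hX', hY.biprod hY', biprod.map f g,
    ⟨dsumIsoBiprod M N ≪≫ biprod.mapIso e e' ≪≫ (cokernelBiprodMapIso f g).symm⟩⟩

theorem IsFP.iteratedSum {X : PersMod k n} {F : ℕ → PersMod k n} (hX : IsFP X)
    (hF : ∀ j, IsFP (F j)) (m : ℕ) : IsFP (iteratedSum X F m) := by
  induction m with
  | zero => exact hX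
  | succ m ih => exact ih.dsum (hF m)

/-- A morphism out of the interval module of a union `I ∪ J` is determined by its restrictions to
`I` and `J`. (The order of `UpperSet` is reverse inclusion, so `I ⊓ J` is the union.) -/
theorem upperModule_inf_hom_ext {I J : UpperSet (Fin n → ℝ)} {T : PersMod k n}
    {d d' : upperModule k (I ⊓ J) ⟶ T}
    (h1 : upperHom k I (I ⊓ J) (fun _ => .inl) ≫ d = upperHom k I (I ⊓ J) (fun _ => .inl) ≫ d')
    (h2 : upperHom k J (I ⊓ J) (fun _ => .inr) ≫ d = upperHom k J (I ⊓ J) (fun _ => .inr) ≫ d') :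
    d = d' := by
  ext r : 2
  apply FGModuleCat.hom_ext
  refine LinearMap.ext fun (x : intervalSpace k (↑(I ⊓ J) : Set (Fin n → ℝ)) r) => ?_
  by_cases hI : r ∈ I
  · have hx : x = intervalCompare k I (↑(I ⊓ J)) r r (intervalCompare k (↑(I ⊓ J)) I r r x) :=
      Subtype.ext <| by
        rw [coe_intervalCompare_of_imp fun _ => .inl hI, coe_intervalCompare_of_imp fun _ => hI]
    rw [hx]
    exact congrArg (fun φ => (φ.app r).hom.hom (intervalCompare k (↑(I ⊓ J)) I r r x)) h1
  by_cases hJ : r ∈ J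
  · have hx : x = intervalCompare k J (↑(I ⊓ J)) r r (intervalCompare k (↑(I ⊓ J)) J r r x) :=
      Subtype.ext <| by
        rw [coe_intervalCompare_of_imp fun _ => .inr hJ, coe_intervalCompare_of_imp fun _ => hJ]
    rw [hx]
    exact congrArg (fun φ => (φ.app r).hom.hom (intervalCompare k (↑(I ⊓ J)) J r r x)) h2
  · have hx : x = 0 := Subtype.ext (mem_intervalSpace.1 x.2 fun h => h.elim hI hJ)
    rw [hx]
    exact (map_zero (d.app r).hom.hom).trans (map_zero (d'.app r).hom.hom).symm

/-- Morphisms out of the interval modules of `I` and `J` that agree on `I ∩ J` glue to the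
union `I ∪ J`. -/
theorem exists_upperModule_inf_hom {I J : UpperSet (Fin n → ℝ)} {T : PersMod k n}
    (h1 : upperModule k I ⟶ T) (h2 : upperModule k J ⟶ T)
    (h : upperHom k (I ⊔ J) I (fun _ => And.left) ≫ h1 =
      upperHom k (I ⊔ J) J (fun _ => And.right) ≫ h2) :
    ∃ d : upperModule k (I ⊓ J) ⟶ T, upperHom k I (I ⊓ J) (fun _ => .inl) ≫ d = h1 ∧
      upperHom k J (I ⊓ J) (fun _ => .inr) ≫ d = h2 := by
  classical
  let H1 (r : Fin n → ℝ) : intervalSpace k (I : Set (Fin n → ℝ)) r →ₗ[k] T.obj r :=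
    (h1.app r).hom.hom
  let H2 (r : Fin n → ℝ) : intervalSpace k (J : Set (Fin n → ℝ)) r →ₗ[k] T.obj r :=
    (h2.app r).hom.hom
  have nat1 : ∀ {r s : Fin n → ℝ} (f : r ⟶ s) (x : intervalSpace k (I : Set (Fin n → ℝ)) r),
      H1 s (intervalMap k I r s x) = (T.map f).hom.hom (H1 r x) := fun f x =>
    congrArg (fun φ => φ.hom.hom x) (h1.naturality f)
  have nat2 : ∀ {r s : Fin n → ℝ} (f : r ⟶ s) (x : intervalSpace k (J : Set (Fin n → ℝ)) r),
      H2 s (intervalMap k J r s x) = (T.map f).hom.hom (H2 r x) := fun f x =>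
    congrArg (fun φ => φ.hom.hom x) (h2.naturality f)
  have agree : ∀ (r : Fin n → ℝ) (x : intervalSpace k (↑(I ⊔ J) : Set (Fin n → ℝ)) r),
      H1 r (intervalCompare k (↑(I ⊔ J)) I r r x) =
        H2 r (intervalCompare k (↑(I ⊔ J)) J r r x) := fun r x =>
    congrArg (fun φ => (φ.app r).hom.hom x) h
  -- `h1` wherever `I` reaches, `h2` elsewhere; by `agree`, this is `h2` on all of `J`.
  let D (r : Fin n → ℝ) : intervalSpace k (↑(I ⊓ J) : Set (Fin n → ℝ)) r →ₗ[k] T.obj r :=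
    if r ∈ I then H1 r ∘ₗ intervalCompare k (↑(I ⊓ J)) I r r
    else H2 r ∘ₗ intervalCompare k (↑(I ⊓ J)) J r r
  have D1 : ∀ r ∈ I, ∀ x, D r x = H1 r (intervalCompare k (↑(I ⊓ J)) I r r x) := by
    intro r hr x
    simp only [D, if_pos hr, LinearMap.comp_apply]
  have D2 : ∀ r ∈ J, ∀ x, D r x = H2 r (intervalCompare k (↑(I ⊓ J)) J r r x) := by
    intro r hr x
    by_cases hI : r ∈ I
    · rw [D1 r hI]
      convert agree r (intervalCompare k (↑(I ⊓ J)) (↑(I ⊔ J)) r r x) using 2 <;>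
      · refine Subtype.ext ?_
        rw [coe_intervalCompare_of_imp, coe_intervalCompare_of_imp, coe_intervalCompare_of_imp] <;>
        simp [hI, hr]
    · simp only [D, if_neg hI, LinearMap.comp_apply]
  let d : upperModule k (I ⊓ J) ⟶ T :=
    { app := fun r => FGModuleCat.ofHom (D r)
      naturality := fun r s f => by
        apply FGModuleCat.hom_ext
        refine LinearMap.ext fun (x : intervalSpace k (↑(I ⊓ J) : Set (Fin n → ℝ)) r) => ?_
        change D s (intervalMap k (↑(I ⊓ J)) r s x) = (T.map f).hom.hom (D r x)
        have hrs : r ≤ s := leOfHom f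
        by_cases hI : r ∈ I
        · have hs : s ∈ I := I.upper hrs hI
          rw [D1 r hI, D1 s hs, ← nat1 f]
          refine congrArg _ (Subtype.ext ?_)
          rw [coe_intervalCompare_of_imp fun _ => hs,
            coe_intervalMap_of_isUpperSet (I ⊓ J).upper hrs,
            coe_intervalMap_of_isUpperSet I.upper hrs, coe_intervalCompare_of_imp fun _ => hI]
        by_cases hJ : r ∈ J
        · have hs : s ∈ J := J.upper hrs hJ
          rw [D2 r hJ, D2 s hs, ← nat2 f]
          refine congrArg _ (Subtype.ext ?_)
          rw [coe_intervalCompare_of_imp fun _ => hs,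
            coe_intervalMap_of_isUpperSet (I ⊓ J).upper hrs,
            coe_intervalMap_of_isUpperSet J.upper hrs, coe_intervalCompare_of_imp fun _ => hJ]
        · have hx : x = 0 := Subtype.ext (mem_intervalSpace.1 x.2 fun h => h.elim hI hJ)
          rw [hx, map_zero, map_zero, map_zero]
          exact (map_zero (T.map f).hom.hom).symm }
  refine ⟨d, ?_, ?_⟩
  · ext r : 2
    apply FGModuleCat.hom_ext
    refine LinearMap.ext fun (x : intervalSpace k (I : Set (Fin n → ℝ)) r) => ?_
    change D r (intervalCompare k I (↑(I ⊓ J)) r r x) = H1 r x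
    by_cases hI : r ∈ I
    · rw [D1 r hI]
      refine congrArg _ (Subtype.ext ?_)
      rw [coe_intervalCompare_of_imp fun _ => hI, coe_intervalCompare_of_imp fun _ => .inl hI]
    · have hx : x = 0 := Subtype.ext (mem_intervalSpace.1 x.2 hI)
      rw [hx, map_zero, map_zero, map_zero]
  · ext r : 2
    apply FGModuleCat.hom_ext
    refine LinearMap.ext fun (x : intervalSpace k (J : Set (Fin n → ℝ)) r) => ?_
    change D r (intervalCompare k J (↑(I ⊓ J)) r r x) = H2 r x
    by_cases hJ : r ∈ J
    · rw [D2 r hJ]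
      refine congrArg _ (Subtype.ext ?_)
      rw [coe_intervalCompare_of_imp fun _ => hJ, coe_intervalCompare_of_imp fun _ => .inr hJ]
    · have hx : x = 0 := Subtype.ext (mem_intervalSpace.1 x.2 hJ)
      rw [hx, map_zero, map_zero, map_zero]

/-- The Mayer–Vietoris presentation `P_{p ∨ q} → P_p ⊕ P_q → k_I → 0` for the upper set `I`
generated by `p` and `q`. -/
theorem isFP_upperModule_Ici_inf_Ici (p q : Fin n → ℝ) :
    IsFP (upperModule k (UpperSet.Ici p ⊓ UpperSet.Ici q)) := by
  rw [isFP_iff]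
  let I := UpperSet.Ici p
  let J := UpperSet.Ici q
  let f : upperModule k (I ⊔ J) ⟶ upperModule k I ⊞ upperModule k J :=
    biprod.lift (upperHom k (I ⊔ J) I fun _ => And.left) (-upperHom k (I ⊔ J) J fun _ => And.right)
  let g : upperModule k I ⊞ upperModule k J ⟶ upperModule k (I ⊓ J) :=
    biprod.desc (upperHom k I (I ⊓ J) fun _ => .inl) (upperHom k J (I ⊓ J) fun _ => .inr)
  have hfg : f ≫ g = 0 := by
    rw [biprod.lift_desc, Preadditive.neg_comp, add_neg_eq_zero]
    ext r : 2
    apply FGModuleCat.hom_ext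
    refine LinearMap.ext fun (x : intervalSpace k (↑(I ⊔ J) : Set (Fin n → ℝ)) r) => ?_
    change intervalCompare k I (↑(I ⊓ J)) r r (intervalCompare k (↑(I ⊔ J)) I r r x) =
      intervalCompare k J (↑(I ⊓ J)) r r (intervalCompare k (↑(I ⊔ J)) J r r x)
    refine Subtype.ext ?_
    rw [coe_intervalCompare_of_imp Or.inl, coe_intervalCompare_of_imp And.left,
      coe_intervalCompare_of_imp Or.inr, coe_intervalCompare_of_imp And.right]
  have hglue : ∀ {T : PersMod k n} (t : upperModule k I ⊞ upperModule k J ⟶ T) (_ : f ≫ t = 0),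
      ∃ d : upperModule k (I ⊓ J) ⟶ T, g ≫ d = t := by
    intro T t ht
    obtain ⟨d, hd1, hd2⟩ := exists_upperModule_inf_hom (biprod.inl ≫ t) (biprod.inr ≫ t) (by
      simp only [f, biprod.lift_eq, Preadditive.add_comp, Preadditive.neg_comp, Preadditive.neg_comp,
        add_neg_eq_zero] at ht
      simpa using ht)
    refine ⟨d, biprod.hom_ext' _ _ ?_ ?_⟩
    · rw [biprod.inl_desc_assoc, hd1]
    · rw [biprod.inr_desc_assoc, hd2]
  have hcolim : IsColimit (CokernelCofork.ofπ g hfg) :=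
    CokernelCofork.IsColimit.ofπ g hfg (fun t ht => (hglue t ht).choose)
      (fun t ht => (hglue t ht).choose_spec) (fun t ht m hm => by
        have hm' := hm.trans (hglue t ht).choose_spec.symm
        apply upperModule_inf_hom_ext
        · simpa only [g, biprod.inl_desc_assoc] using congrArg (fun φ => biprod.inl ≫ φ) hm'
        · simpa only [g, biprod.inr_desc_assoc] using congrArg (fun φ => biprod.inr ≫ φ) hm')
  have hsup : I ⊔ J = UpperSet.Ici (p ⊔ q) := (UpperSet.Ici_sup p q).symm
  refine ⟨_, _, ?_, (IsFreeSum.indecProjective p).biprod (.indecProjective q), f,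
    ⟨hcolim.coconePointUniqueUpToIso (colimit.isColimit (parallelPair f 0))⟩⟩
  rw [hsup]
  exact .indecProjective (p ⊔ q)

/-! ### Lower bounds for interleavings and matchings -/

theorem Interleaved.symm {ε : ℝ≥0} {M N : PersMod k n} (h : Interleaved ε M N) :
    Interleaved ε N M := by
  obtain ⟨f, g, h1, h2⟩ := h
  exact ⟨g, f, h2, h1⟩

theorem structMap_eq_zero_of_rank_eq_zero {M : PersMod k n} {a b : Fin n → ℝ} {h : a ≤ b}
    (h0 : rank M h = 0) : structMap M h = 0 := by
  apply FGModuleCat.hom_ext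
  have h1 : Module.finrank k (LinearMap.range (structMap M h).hom.hom) = 0 :=
    Int.natCast_eq_zero.1 h0
  exact LinearMap.range_eq_bot.1 (Submodule.finrank_eq_zero.1 h1)

theorem rank_eq_zero_of_structMap_eq_zero {M : PersMod k n} {a b : Fin n → ℝ} {h : a ≤ b}
    (h0 : structMap M h = 0) : rank M h = 0 := by
  unfold rank
  rw [h0]
  exact_mod_cast (congrArg (fun W : Submodule k (M.obj b) => Module.finrank k W)
    (LinearMap.range_zero (M := M.obj a))).trans (finrank_bot k (M.obj b))

theorem rank_zero {a b : Fin n → ℝ} (h : a ≤ b) : rank (0 : PersMod k n) h = 0 :=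
  rank_eq_zero_of_structMap_eq_zero
    (((Functor.isZero_iff _).1 (isZero_zero (PersMod k n)) a).eq_of_src _ _)

/-- If `M` and `N` are `ε`-interleaved and `N(r + ε) = 0`, then `M(r) → M(r + 2ε)` vanishes,
because it factors through `N(r + ε)`. -/
theorem Interleaved.rank_eq_zero {ε : ℝ≥0} {M N : PersMod k n} (h : Interleaved ε M N)
    {r : Fin n → ℝ} (hN : rank N (le_refl (r + fun _ => (ε : ℝ))) = 0)
    (h' : r ≤ r + (fun _ => (ε : ℝ)) + (fun _ => (ε : ℝ))) : rank M h' = 0 := by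
  obtain ⟨f, g, h1, -⟩ := h
  have hid : 𝟙 (N.obj (r + fun _ => (ε : ℝ))) = 0 :=
    (N.map_id _).symm.trans (structMap_eq_zero_of_rank_eq_zero hN)
  apply rank_eq_zero_of_structMap_eq_zero
  rw [← h1 r]
  have hf : f.app r = 0 := (Category.comp_id (f.app r)).symm.trans
    ((congrArg (fun φ => f.app r ≫ φ) hid).trans comp_zero)
  rw [hf, zero_comp]

open Classical in
theorem rank_indecProjective (p : Fin n → ℝ) {a b : Fin n → ℝ} (h : a ≤ b) :
    rank (indecProjective k p) h = if p ≤ a then 1 else 0 :=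
  rank_upperModule (UpperSet.Ici p) h

theorem le_add_of_interleaved_indecProjective {ε : ℝ≥0} {p q : Fin n → ℝ}
    (h : Interleaved ε (indecProjective k p) (indecProjective k q)) :
    q ≤ p + fun _ => (ε : ℝ) := by
  classical
  by_contra hpq
  have h0 : p ≤ p + (fun _ => (ε : ℝ)) + (fun _ => (ε : ℝ)) := fun i => by simp [add_assoc]
  have h1 := h.rank_eq_zero (r := p) (by rw [rank_indecProjective, if_neg hpq]) h0
  rw [rank_indecProjective, if_pos le_rfl] at h1
  exact one_ne_zero h1

theorem not_interleaved_indecProjective_zero {ε : ℝ≥0} {p : Fin n → ℝ} :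
    ¬ Interleaved ε (indecProjective k p) (0 : PersMod k n) := by
  classical
  intro h
  have h0 : p ≤ p + (fun _ => (ε : ℝ)) + (fun _ => (ε : ℝ)) := fun i => by simp [add_assoc]
  have h1 := h.rank_eq_zero (r := p) (rank_zero _) h0
  rw [rank_indecProjective, if_pos le_rfl] at h1
  exact one_ne_zero h1

/-- A bar of `D` that is not close to the zero module and not close to any bar of `C` bounds
the bottleneck distance from below. -/
theorem le_bottleneckDist {C D : Barcode k n} {t : ℝ≥0} {d : Bar k n} (hd : d ∈ D)
    (h0 : ∀ ε, Bar.InterleavedZero ε d → t ≤ ε)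
    (h : ∀ ε, ∀ c ∈ C, Bar.Interleaved ε c d → t ≤ ε) : (t : ℝ≥0∞) ≤ bottleneckDist C D := by
  classical
  refine le_iInf₂ fun ε ⟨m, h1, _, h3⟩ => ENNReal.coe_le_coe.2 ?_
  let j : D.ToType := ⟨d, ⟨0, Multiset.count_pos.2 hd⟩⟩
  cases hj : m.symm j with
  | none => exact h0 ε (h3 j hj)
  | some i => exact h ε i.1 Multiset.coe_mem (h1 i j ((PEquiv.eq_some_iff m).1 hj))

/-- The isomorphism class of an indecomposable projective. -/
def freeBar (k : Type u) [Field k] (p : Fin n → ℝ) : Bar k n :=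
  Bar.mk (indecProjective k p) (indecomposable_intervalModule _ isLeast_Ici)

open Classical in
theorem rank_freeBar (p : Fin n → ℝ) {a b : Fin n → ℝ} (h : a ≤ b) :
    Bar.rank h (freeBar k p) = if p ≤ a then 1 else 0 :=
  rank_indecProjective p h

theorem isRectangle_freeBar (p : Fin n → ℝ) : Bar.IsRectangle (freeBar k p) := by
  refine ⟨_, _, ⟨p, fun _ => ⊤, fun i => WithTop.coe_lt_top _, ⟨eqToIso ?_⟩⟩, rfl⟩
  have hs : Set.Ici p = rectangle p fun _ => ⊤ :=
    Set.ext fun r => ⟨fun hr i => ⟨hr i, WithTop.coe_lt_top _⟩, fun hr i => (hr i).1⟩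
  unfold indecProjective
  congr 1

/-! ### Points in a coordinate plane -/

/-- The point `(x, y, 0, …, 0)` of `ℝⁿ`. -/
def planePt (n : ℕ) (x y : ℝ) : Fin n → ℝ :=
  fun i => if (i : ℕ) = 0 then x else if (i : ℕ) = 1 then y else 0

theorem planePt_le_add_iff (hn : 2 ≤ n) {x y x' y' : ℝ} (ε : ℝ≥0) :
    planePt n x y ≤ planePt n x' y' + (fun _ => (ε : ℝ)) ↔ x ≤ x' + ε ∧ y ≤ y' + ε := by
  constructor
  · intro h
    exact ⟨by simpa [planePt] using h ⟨0, by omega⟩, by simpa [planePt] using h ⟨1, by omega⟩⟩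
  · rintro ⟨hx, hy⟩ i
    simp only [planePt, Pi.add_apply]
    split_ifs
    · exact hx
    · exact hy
    · simp

theorem planePt_le_iff (hn : 2 ≤ n) {x y x' y' : ℝ} :
    planePt n x y ≤ planePt n x' y' ↔ x ≤ x' ∧ y ≤ y' := by
  have h := planePt_le_add_iff hn (x := x) (y := y) (x' := x') (y' := y') 0
  have h0 : (fun _ : Fin n => ((0 : ℝ≥0) : ℝ)) = 0 := rfl
  rwa [h0, add_zero, NNReal.coe_zero, add_zero, add_zero] at h

theorem planePt_sup (x y x' y' : ℝ) :
    planePt n x y ⊔ planePt n x' y' = planePt n (x ⊔ x') (y ⊔ y') := by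
  ext i
  simp only [planePt, Pi.sup_apply]
  split_ifs <;> simp

/-! ### The two families of modules -/

/-- The free module with generators at `(Nε, 0)` and at `(jε, -1)` for `j < N`. -/
def chainModule (k : Type u) [Field k] (n : ℕ) (ε : ℝ) (N : ℕ) : PersMod k n :=
  iteratedSum (indecProjective k (planePt n (N * ε) 0))
    (fun j => indecProjective k (planePt n (j * ε) (-1))) N

/-- The upper set generated by `((j + 1)ε, -1)` and `(jε, 0)`. -/
def step (n : ℕ) (ε : ℝ) (j : ℕ) : UpperSet (Fin n → ℝ) :=
  UpperSet.Ici (planePt n ((j + 1 : ℕ) * ε) (-1)) ⊓ UpperSet.Ici (planePt n (j * ε) 0)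

/-- The direct sum of the free module with a generator at `(Nε, 0)` and of the interval modules of
the upper sets `step n ε j` for `j < N`. -/
def stepModule (k : Type u) [Field k] (n : ℕ) (ε : ℝ) (N : ℕ) : PersMod k n :=
  iteratedSum (indecProjective k (planePt n (N * ε) 0)) (fun j => upperModule k (step n ε j)) N

/-- The barcode of `chainModule`. -/
def chainBarcode (k : Type u) [Field k] (n : ℕ) (ε : ℝ) (N : ℕ) : Barcode k n :=
  freeBar k (planePt n (N * ε) 0) ::ₘ
    (Multiset.range N).map fun j : ℕ => freeBar k (planePt n (j * ε) (-1))

/-- The barcode of `stepModule`. -/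
def stepBarcode (k : Type u) [Field k] (n : ℕ) (ε : ℝ) (N : ℕ) : Barcode k n :=
  freeBar k (planePt n 0 0) ::ₘ
    (Multiset.range N).map fun j : ℕ => freeBar k (planePt n ((j + 1 : ℕ) * ε) (-1))

theorem isFP_chainModule (ε : ℝ) (N : ℕ) : IsFP (chainModule k n ε N) :=
  (IsFP.indecProjective _).iteratedSum (fun _ => .indecProjective _) N

theorem isFP_stepModule (ε : ℝ) (N : ℕ) : IsFP (stepModule k n ε N) :=
  (IsFP.indecProjective _).iteratedSum (fun _ => isFP_upperModule_Ici_inf_Ici _ _) N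

theorem interleaved_chainModule_stepModule (hn : 2 ≤ n) (ε : ℝ≥0) (N : ℕ) :
    Interleaved ε (chainModule k n ε N) (stepModule k n ε N) := by
  have hself : ∀ I : UpperSet (Fin n → ℝ), ∀ r ∈ I, r + (fun _ => (ε : ℝ)) ∈ I := fun I r hr =>
    I.upper (show r ≤ r + fun _ => (ε : ℝ) from fun i => by simp) hr
  refine Interleaved.iteratedSum (interleaved_upperModule (I := UpperSet.Ici _)
    (J := UpperSet.Ici _) (hself _) (hself _)) N fun j _ =>
    interleaved_upperModule (I := UpperSet.Ici _) ?_ ?_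
  · intro r hr
    refine Or.inl (le_trans ((planePt_le_add_iff hn ε).2 ?_) (add_le_add_left hr _))
    push_cast
    constructor <;> linarith [ε.2]
  · intro r hr
    refine hself _ r ?_
    rcases hr with hr | hr <;> refine le_trans ((planePt_le_iff hn).2 ?_) hr
    · push_cast
      constructor <;> linarith [ε.2]
    · constructor <;> linarith

open Classical in
theorem sum_rank_freeBar (p : Fin n → ℝ) (q : ℕ → Fin n → ℝ) (N : ℕ) {a b : Fin n → ℝ}
    (h : a ≤ b) :
    ((freeBar k p ::ₘ (Multiset.range N).map fun j => freeBar k (q j)).map (Bar.rank h)).sum =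
      (if p ≤ a then 1 else 0) + ∑ j ∈ Finset.range N, if q j ≤ a then 1 else 0 := by
  rw [Multiset.map_cons, Multiset.sum_cons, rank_freeBar, Multiset.map_map]
  congr 1
  exact congrArg Multiset.sum (Multiset.map_congr rfl fun j _ => rank_freeBar (q j) h)

theorem rank_chainModule (ε : ℝ) (N : ℕ) {a b : Fin n → ℝ} (h : a ≤ b) :
    rank (chainModule k n ε N) h = ((chainBarcode k n ε N).map (Bar.rank h)).sum := by
  classical
  rw [chainModule, chainBarcode, rank_iteratedSum, sum_rank_freeBar]
  simp only [rank_indecProjective]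

/-- By inclusion–exclusion, the rank invariant of the `j`-th step is that of the generators
`((j + 1)ε, -1)` and `(jε, 0)` minus that of their join `((j + 1)ε, 0)`. This join is the second
generator of the next step, so the sum telescopes. -/
theorem rank_stepModule {ε : ℝ} (hε : 0 ≤ ε) (N : ℕ) {a b : Fin n → ℝ} (h : a ≤ b) :
    rank (stepModule k n ε N) h = ((stepBarcode k n ε N).map (Bar.rank h)).sum := by
  classical
  let G (j : ℕ) : ℤ := if planePt n (j * ε) 0 ≤ a then 1 else 0
  have hstep : ∀ j : ℕ, rank (upperModule k (step n ε j)) h =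
      (if planePt n ((j + 1 : ℕ) * ε) (-1) ≤ a then 1 else 0) + (G j - G (j + 1)) := by
    intro j
    have hjoin : planePt n ((j + 1 : ℕ) * ε) 0 ≤ a ↔
        planePt n ((j + 1 : ℕ) * ε) (-1) ≤ a ∧ planePt n (j * ε) 0 ≤ a := by
      rw [← sup_le_iff, planePt_sup, sup_eq_left.2, sup_eq_right.2]
      · norm_num
      · push_cast
        linarith
    have hmem : a ∈ step n ε j ↔
        planePt n ((j + 1 : ℕ) * ε) (-1) ≤ a ∨ planePt n (j * ε) 0 ≤ a := Iff.rfl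
    rw [rank_upperModule]
    simp only [G, hmem, hjoin]
    split_ifs <;> simp_all
  rw [stepModule, stepBarcode, rank_iteratedSum, sum_rank_freeBar, rank_indecProjective,
    Finset.sum_congr rfl fun j _ => hstep j, Finset.sum_add_distrib, Finset.sum_range_sub']
  simp only [G, Nat.cast_zero, zero_mul]
  ring

/-- A barcode of free modules with the rank invariant of `M`, with empty negative part, is the
minimal rank decomposition of `M` by rectangles. -/
theorem isMinimalRankDecomposition_of_freeBars {M : PersMod k n} (p : Fin n → ℝ)
    (q : ℕ → Fin n → ℝ) (N : ℕ)
    (h : ∀ (a b : Fin n → ℝ) (h : a ≤ b), rank M h =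
      ((freeBar k p ::ₘ (Multiset.range N).map fun j => freeBar k (q j)).map (Bar.rank h)).sum) :
    IsMinimalRankDecompositionByRectangles M
      ⟨freeBar k p ::ₘ (Multiset.range N).map fun j => freeBar k (q j), 0⟩ where
  pos_isRectangle c hc := by
    replace hc : c ∈ freeBar k p ::ₘ (Multiset.range N).map fun j => freeBar k (q j) := hc
    rcases Multiset.mem_cons.1 hc with rfl | hc
    · exact isRectangle_freeBar _
    · obtain ⟨j, -, rfl⟩ := Multiset.mem_map.1 hc
      exact isRectangle_freeBar _
  neg_isRectangle c hc := absurd hc (Multiset.notMem_zero c)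
  disjoint := disjoint_bot_right
  isRankDecomposition a b hab := by
    rw [h a b hab, Multiset.map_zero, Multiset.sum_zero, sub_zero]

/-- The bar `(0, 0)` of `stepModule` is at distance at least `1` from each bar of `chainModule`. -/
theorem one_le_signedBottleneckDissim (hn : 2 ≤ n) {ε : ℝ} {N : ℕ} (hN : 1 ≤ N * ε) :
    1 ≤ signedBottleneckDissim ⟨chainBarcode k n ε N, 0⟩ ⟨stepBarcode k n ε N, 0⟩ := by
  change 1 ≤ bottleneckDist (chainBarcode k n ε N + 0) (stepBarcode k n ε N + 0)
  rw [add_zero, add_zero]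
  refine le_bottleneckDist (t := 1) (d := freeBar k (planePt n 0 0)) (Multiset.mem_cons_self _ _)
    (fun δ hδ => (not_interleaved_indecProjective_zero (k := k) hδ).elim) fun δ c hc h => ?_
  rw [← NNReal.coe_le_coe, NNReal.coe_one]
  rcases Multiset.mem_cons.1 hc with rfl | hc
  · have := (planePt_le_add_iff hn δ).1
      (le_add_of_interleaved_indecProjective (Interleaved.symm (k := k) h))
    linarith [this.1]
  · obtain ⟨j, -, rfl⟩ := Multiset.mem_map.1 hc
    have := (planePt_le_add_iff hn δ).1 (le_add_of_interleaved_indecProjective (k := k) h)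
    linarith [this.2]

/-- At `(0, -1)` the chain module has a generator, which survives under all structure maps, whereas
the step module vanishes at `(δ, -1 + δ, δ, …, δ)` for `δ < ε`. -/
theorem le_of_interleaved_chainModule_stepModule (hn : 2 ≤ n) {ε δ : ℝ≥0} {N : ℕ} (hN : 1 ≤ N)
    (hε : ε ≤ 1) (h : Interleaved δ (chainModule k n ε N) (stepModule k n ε N)) : ε ≤ δ := by
  classical
  by_contra! hlt
  have hlt' : (δ : ℝ) < ε := hlt
  have hε' : (ε : ℝ) ≤ 1 := hε
  have hr : planePt n 0 (-1) ≤
    planePt n 0 (-1) + (fun _ => (δ : ℝ)) + (fun _ => (δ : ℝ)) := fun i => by simp [add_assoc]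
  have h0 : rank (stepModule k n ε N) (le_refl (planePt n 0 (-1) + fun _ => (δ : ℝ))) = 0 := by
    rw [rank_stepModule ε.coe_nonneg, stepBarcode, sum_rank_freeBar, if_neg, zero_add]
    · refine Finset.sum_eq_zero fun j _ => if_neg ?_
      rw [planePt_le_add_iff hn]
      push_cast
      rintro ⟨h1, -⟩
      have : 0 ≤ (j : ℝ) * ε := by positivity
      linarith
    · rw [planePt_le_add_iff hn]
      rintro ⟨-, h2⟩
      linarith
  have h1 := h.rank_eq_zero h0 hr
  rw [rank_chainModule, chainBarcode, sum_rank_freeBar] at h1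
  have h2 : (1 : ℤ) ≤ ∑ j ∈ Finset.range N,
      if planePt n (j * (ε : ℝ)) (-1) ≤ planePt n 0 (-1) then 1 else 0 := by
    refine le_trans (by simp) (Finset.single_le_sum (f := fun j : ℕ =>
      if planePt n (j * (ε : ℝ)) (-1) ≤ planePt n 0 (-1) then (1 : ℤ) else 0)
      (fun j _ => by positivity) (Finset.mem_range.2 hN))
  have h3 : (0 : ℤ) ≤ if planePt n (N * (ε : ℝ)) 0 ≤ planePt n 0 (-1) then 1 else 0 := by
    positivity
  linarith

theorem interleavingDist_chainModule_stepModule (hn : 2 ≤ n) {ε : ℝ≥0} {N : ℕ} (hN : 1 ≤ N)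
    (hε : ε ≤ 1) : interleavingDist (chainModule k n ε N) (stepModule k n ε N) = ε :=
  le_antisymm (iInf₂_le ε (interleaved_chainModule_stepModule hn ε N))
    (le_iInf₂ fun _ h =>
      ENNReal.coe_le_coe.2 (le_of_interleaved_chainModule_stepModule hn hN hε h))

end Persistence

end

theorem mainTheorem4 (k : Type u) [Field k] (n : ℕ) (hn : 2 ≤ n) :
    (¬ ∃ f : ℝ≥0 → ℝ≥0, Tendsto f (𝓝[≠] 0) (𝓝 0) ∧
      ∀ M N : Persistence.PersMod k n, Persistence.IsFP M → Persistence.IsFP N →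
        ∀ C D : Persistence.SignedBarcode k n,
          Persistence.IsMinimalRankDecompositionByRectangles M C →
          Persistence.IsMinimalRankDecompositionByRectangles N D →
          Persistence.interleavingDist M N ≠ ∞ →
          Persistence.signedBottleneckDissim C D ≤
            (f (Persistence.interleavingDist M N).toNNReal : ℝ≥0∞)) ∧
    (∃ (A B : ℕ → Persistence.PersMod k n) (C D : ℕ → Persistence.SignedBarcode k n),
      (∀ i, Persistence.IsFP (A i) ∧ Persistence.IsFP (B i) ∧
        Persistence.IsMinimalRankDecompositionByRectangles (A i) (C i) ∧
        Persistence.IsMinimalRankDecompositionByRectangles (B i) (D i) ∧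
        1 ≤ Persistence.signedBottleneckDissim (C i) (D i)) ∧
      Tendsto (fun i => Persistence.interleavingDist (A i) (B i)) atTop (𝓝 0)) := by
  let ε (i : ℕ) : ℝ≥0 := ((i + 1 : ℕ) : ℝ≥0)⁻¹
  let A (i : ℕ) := Persistence.chainModule k n (ε i) (i + 1)
  let B (i : ℕ) := Persistence.stepModule k n (ε i) (i + 1)
  let C (i : ℕ) : Persistence.SignedBarcode k n := ⟨Persistence.chainBarcode k n (ε i) (i + 1), 0⟩
  let D (i : ℕ) : Persistence.SignedBarcode k n := ⟨Persistence.stepBarcode k n (ε i) (i + 1), 0⟩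
  have hε : Tendsto ε atTop (𝓝 0) :=
    (tendsto_inv_atTop_nhds_zero_nat (𝕜 := ℝ≥0)).comp (tendsto_add_atTop_nat 1)
  have hdist : ∀ i, Persistence.interleavingDist (A i) (B i) = ε i := fun i =>
    Persistence.interleavingDist_chainModule_stepModule hn (Nat.le_add_left 1 i)
      (inv_le_one_of_one_le₀ (by exact_mod_cast Nat.le_add_left 1 i))
  have hC : ∀ i, Persistence.IsMinimalRankDecompositionByRectangles (A i) (C i) := fun i =>
    Persistence.isMinimalRankDecomposition_of_freeBars _ _ _ fun _ _ h =>
      Persistence.rank_chainModule _ _ h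
  have hD : ∀ i, Persistence.IsMinimalRankDecompositionByRectangles (B i) (D i) := fun i =>
    Persistence.isMinimalRankDecomposition_of_freeBars _ _ _ fun _ _ h =>
      Persistence.rank_stepModule (ε i).coe_nonneg _ h
  have hdissim : ∀ i, 1 ≤ Persistence.signedBottleneckDissim (C i) (D i) := fun i => by
    refine Persistence.one_le_signedBottleneckDissim hn (le_of_eq ?_)
    have : ((i : ℝ) + 1) ≠ 0 := by positivity
    simp [ε, this]
  refine ⟨?_, A, B, C, D, fun i => ⟨Persistence.isFP_chainModule _ _,
    Persistence.isFP_stepModule _ _, hC i, hD i, hdissim i⟩, ?_⟩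
  · rintro ⟨f, hf, hle⟩
    have hε' : Tendsto ε atTop (𝓝[≠] 0) :=
      tendsto_nhdsWithin_iff.2 ⟨hε, Eventually.of_forall fun i => by simp [ε]⟩
    -- `f` tends to `0` along the nonzero distances `ε i`, so `f (ε i) < 1` for some `i`.
    obtain ⟨i, hi⟩ := ((hf.comp hε').eventually (gt_mem_nhds zero_lt_one)).exists
    have h1 := (hdissim i).trans (hle (A i) (B i) (Persistence.isFP_chainModule _ _)
      (Persistence.isFP_stepModule _ _) _ _ (hC i) (hD i) (by rw [hdist]; exact ENNReal.coe_ne_top))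
    rw [hdist, ENNReal.toNNReal_coe] at h1
    exact absurd (ENNReal.one_le_coe_iff.1 h1) (not_le.2 hi)
  · simp only [hdist]
    exact ENNReal.tendsto_coe.2 hε
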